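/- Let $n\ge 1$. Let $\mathfrak{sp}_{2n}(\mathbb{C})$ be the Lie algebra of complex $2n\times 2n$ matrices $\begin{pmatrix}A&B\\ C&-A^{T}\end{pmatrix}$ with $A,B,C\in M_n(\mathbb{C})$, $B=B^{T}$, $C=C^{T}$. Let $H_n=\mathbb{C}^{2n}\oplus\mathbb{C}z$ be the Heisenberg Lie algebra, in which $[e_i,e_{n+i}]=z$ for $1\le i\le n$, all other brackets $[e_j,e_k]$ with $j<k$ of standard basis vectors vanish, and $z$ is central. The symplectic oscillator algebra is the semidirect product $\mathfrak{g}_n=\mathfrak{sp}_{2n}(\mathbb{C})\ltimes H_n$, with $[x,v]=xv$ (matrix times vector) and $[x,z]=0$ for $x\in\mathfrak{sp}_{2n}(\mathbb{C})$, $v\in\mathbb{C}^{2n}$. Theorem. Every symmetric biderivation of $\mathfrak{g}_n$ is zero: if $\delta:\mathfrak{g}_n\times\mathfrak{g}_n\to\mathfrak{g}_n$ is a bilinear map such that $$\delta([x,y],w)=[x,\delta(y,w)]-[y,\delta(x,w)],\qquad \delta(x,[y,w])=[y,\delta(x,w)]-[w,\delta(x,y)],\qquad \delta(x,y)=\delta(y,x)$$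 for all $x,y,w\in\mathfrak{g}_n$, then $\delta=0$. -/

import Mathlib

/-- A bilinear map `δ : L × L → M` from a Lie algebra to a Lie module is a biderivation if it is a
derivation in each argument. -/
structure IsBiderivation {R L M : Type*} [CommRing R] [LieRing L] [LieAlgebra R L]
    [AddCommGroup M] [Module R M] [LieRingModule L M] [LieModule R L M]
    (δ : L →ₗ[R] L →ₗ[R] M) : Prop where
  left : ∀ x y z : L, δ ⁅x, y⁆ z = ⁅x, δ y z⁆ - ⁅y, δ x z⁆
  right : ∀ x y z : L, δ x ⁅y, z⁆ = ⁅y, δ x z⁆ - ⁅z, δ x y⁆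

/-- A biderivation is symmetric if `δ(x, y) = δ(y, x)`. -/
structure IsSymmetricBiderivation {R L M : Type*} [CommRing R] [LieRing L] [LieAlgebra R L]
    [AddCommGroup M] [Module R M] [LieRingModule L M] [LieModule R L M]
    (δ : L →ₗ[R] L →ₗ[R] M) : Prop extends IsBiderivation δ where
  symm : ∀ x y : L, δ x y = δ y x

/-- The Heisenberg Lie algebra `H_n = ℂ²ⁿ ⊕ ℂ z`: the element `⟨v, c⟩` stands for `v + c z`.
The coordinates of `ℂ²ⁿ` are indexed by `Fin n ⊕ Fin n`, so that `Sum.inl i` is the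
index `i` and `Sum.inr i` is the index `n + i`. -/
@[ext] structure Heisenberg (n : ℕ) where
  vec : Fin n ⊕ Fin n → ℂ
  central : ℂ

namespace Heisenberg

variable {n : ℕ}

/-- The underlying vector space is `ℂ²ⁿ × ℂ`. -/
def toProd : Heisenberg n ≃ (Fin n ⊕ Fin n → ℂ) × ℂ where
  toFun x := (x.vec, x.central)
  invFun p := ⟨p.1, p.2⟩
  left_inv _ := rfl
  right_inv _ := rfl

instance : AddCommGroup (Heisenberg n) := toProd.addCommGroup

instance : Module ℂ (Heisenberg n) := toProd.module ℂ

@[simp] theorem vec_zero : (0 : Heisenberg n).vec = 0 := rfl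
@[simp] theorem central_zero : (0 : Heisenberg n).central = 0 := rfl
@[simp] theorem vec_add (x y : Heisenberg n) : (x + y).vec = x.vec + y.vec := rfl
@[simp] theorem central_add (x y : Heisenberg n) :
    (x + y).central = x.central + y.central := rfl
@[simp] theorem vec_sub (x y : Heisenberg n) : (x - y).vec = x.vec - y.vec := rfl
@[simp] theorem central_sub (x y : Heisenberg n) :
    (x - y).central = x.central - y.central := rfl
@[simp] theorem vec_smul (c : ℂ) (x : Heisenberg n) : (c • x).vec = c • x.vec := rfl
@[simp] theorem central_smul (c : ℂ) (x : Heisenberg n) :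
    (c • x).central = c • x.central := rfl

/-- The alternating form on `ℂ²ⁿ` with `ω(e_i, e_{n+i}) = 1 = -ω(e_{n+i}, e_i)` and all other
values on pairs of basis vectors equal to `0`. -/
def form (v w : Fin n ⊕ Fin n → ℂ) : ℂ :=
  ∑ i, (v (Sum.inl i) * w (Sum.inr i) - v (Sum.inr i) * w (Sum.inl i))

theorem form_eq_dotProduct (v w : Fin n ⊕ Fin n → ℂ) :
    form v w = -(v ⬝ᵥ (Matrix.J (Fin n) ℂ).mulVec w) := by
  simp [form, Matrix.J, dotProduct, Matrix.mulVec, Matrix.fromBlocks_apply₁₁, Matrix.one_apply,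
    Finset.sum_sub_distrib]
  ring

/-- The bracket `[v + a z, w + b z] = ω(v, w) z`. -/
instance : Bracket (Heisenberg n) (Heisenberg n) where
  bracket x y := ⟨0, form x.vec y.vec⟩

@[simp] theorem vec_lie (x y : Heisenberg n) : ⁅x, y⁆.vec = 0 := rfl
@[simp] theorem central_lie (x y : Heisenberg n) : ⁅x, y⁆.central = form x.vec y.vec := rfl

instance : LieRing (Heisenberg n) where
  add_lie x y z := by
    ext <;> simp [form, add_mul, Finset.sum_add_distrib]
    ring
  lie_add x y z := by
    ext <;> simp [form, mul_add, Finset.sum_add_distrib]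
    ring
  lie_self x := by
    ext <;> simp [form, mul_comm]
  leibniz_lie x y z := by
    ext <;> simp [form]

instance : LieAlgebra ℂ (Heisenberg n) where
  lie_smul c x y := by
    ext <;> simp [form, mul_sub, Finset.mul_sum, mul_left_comm]

end Heisenberg

/-- `sp_{2n}(ℂ)` preserves the form infinitesimally. -/
theorem Heisenberg.form_sp {n : ℕ} (A : LieAlgebra.Symplectic.sp (Fin n) ℂ)
    (v w : Fin n ⊕ Fin n → ℂ) :
    Heisenberg.form (A.1.mulVec v) w + Heisenberg.form v (A.1.mulVec w) = 0 := by
  have h : A.1.transpose * Matrix.J (Fin n) ℂ = Matrix.J (Fin n) ℂ * -A.1 := by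
    simpa [LieAlgebra.Symplectic.sp, Matrix.IsSkewAdjoint, Matrix.IsAdjointPair] using A.2
  have h2 : A.1.mulVec v ⬝ᵥ (Matrix.J (Fin n) ℂ).mulVec w
      = v ⬝ᵥ (A.1.transpose * Matrix.J (Fin n) ℂ).mulVec w := by
    rw [← Matrix.mulVec_mulVec, Matrix.dotProduct_mulVec v, Matrix.vecMul_transpose]
  rw [Heisenberg.form_eq_dotProduct, Heisenberg.form_eq_dotProduct, h2, h, Matrix.mul_neg,
    Matrix.neg_mulVec, dotProduct_neg, Matrix.mulVec_mulVec]
  ring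

/-- The action of `sp_{2n}(ℂ)` on `H_n` by derivations, `A (v + c z) = A v`. -/
def symplecticAction (n : ℕ) :
    LieAlgebra.Symplectic.sp (Fin n) ℂ →ₗ⁅ℂ⁆ LieDerivation ℂ (Heisenberg n) (Heisenberg n) where
  toFun A :=
    { toFun := fun x => ⟨A.1.mulVec x.vec, 0⟩
      map_add' := fun x y => by ext <;> simp [Matrix.mulVec_add]
      map_smul' := fun c x => by ext <;> simp [Matrix.mulVec_smul]
      leibniz' := fun x y => by
        ext
        · simp
        · have h := Heisenberg.form_sp A x.vec y.vec
          have h' : Heisenberg.form y.vec (A.1.mulVec x.vec)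
              = - Heisenberg.form (A.1.mulVec x.vec) y.vec := by
            simp only [Heisenberg.form, ← Finset.sum_neg_distrib]
            exact Finset.sum_congr rfl fun i _ => by ring
          simp only [LinearMap.coe_mk, AddHom.coe_mk, Heisenberg.central_sub,
            Heisenberg.central_lie, h']
          linear_combination -h }
  map_add' A B := by
    ext x <;> simp [Matrix.add_mulVec]
  map_smul' c A := by
    ext x <;> simp [Matrix.smul_mulVec]
  map_lie' {A B} := by
    ext x <;> simp [Ring.lie_def, Matrix.sub_mulVec,
      Matrix.mulVec_mulVec]

/-- The symplectic oscillator algebra `g_n = sp_{2n}(ℂ) ⋉ H_n`. -/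
abbrev SymplecticOscillator (n : ℕ) : Type :=
  LieAlgebra.SemiDirectSum (Heisenberg n) (LieAlgebra.Symplectic.sp (Fin n) ℂ) (symplecticAction n)

/-! Write `V` for ℂ²ⁿ and `E = levi 1 = diag(1, -1)`. Then `E² = 1` on `V`, while `(ad E)²` has
eigenvalues 0 and 4 on `sp`. Each `δ a` is a derivation, so projecting its Leibniz rule to `V`, `ℂz`
and `sp` relates the components of `δ`. Centrality of `z` and perfectness of the algebra give `δ a z
= 0`. The `sp` part of `δ a` on `V` is equivariant, hence zero by the eigenvalues. The crux is
`toCentral_apply_ofVec_ofVec`: for the form `β(v, w) = toCentral (δ v w)` every `x` in `sp` is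
self-adjoint, so a commutator is both self-adjoint and skew, and `β = 0`. Nondegeneracy of `form`
and faithfulness of `V` kill the rest. Symmetry is essential: the Lie bracket is itself a
biderivation. -/

open LieAlgebra.Symplectic Matrix

/-! ### Block structure of `sp`, its perfectness, and the element `E`. -/

namespace LieAlgebra.Symplectic

variable {n : ℕ}

theorem fromBlocks_mem_sp (A B C : Matrix (Fin n) (Fin n) ℂ) (hB : Bᵀ = B) (hC : Cᵀ = C) :
    fromBlocks A B C (-Aᵀ) ∈ sp (Fin n) ℂ := by
  simp [sp, Matrix.IsSkewAdjoint, Matrix.IsAdjointPair, Matrix.J, fromBlocks_transpose,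
    fromBlocks_multiply, fromBlocks_neg, hB, hC]

theorem exists_eq_fromBlocks (x : sp (Fin n) ℂ) : ∃ A B C : Matrix (Fin n) (Fin n) ℂ,
    Bᵀ = B ∧ Cᵀ = C ∧ x.1 = fromBlocks A B C (-Aᵀ) := by
  obtain ⟨x, hx⟩ := x
  obtain ⟨A, B, C, D, rfl⟩ : ∃ A B C D, x = fromBlocks A B C D :=
    ⟨_, _, _, _, (fromBlocks_toBlocks x).symm⟩
  simp only [sp, mem_skewAdjointMatricesLieSubalgebra, mem_skewAdjointMatricesSubmodule,
    Matrix.IsSkewAdjoint, Matrix.IsAdjointPair, Matrix.J, fromBlocks_transpose,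
    fromBlocks_multiply, fromBlocks_neg, fromBlocks_inj] at hx
  simp at hx
  obtain ⟨hC, hD, hA, hB⟩ := hx
  refine ⟨A, B, C, hB, hC, ?_⟩
  simp [← hD]

/-- The element `diag(A, -Aᵀ)` of `sp_{2n}(ℂ)`, as a linear function of `A`. -/
def levi : Matrix (Fin n) (Fin n) ℂ →ₗ[ℂ] sp (Fin n) ℂ where
  toFun A := ⟨fromBlocks A 0 0 (-Aᵀ), fromBlocks_mem_sp A 0 0 (by simp) (by simp)⟩
  map_add' A B := by
    ext1; simp [fromBlocks_add, add_comm]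
  map_smul' c A := by
    ext1; simp [fromBlocks_smul]

/-- The element of `sp_{2n}(ℂ)` with upper right block `B`. -/
def upper (B : Matrix (Fin n) (Fin n) ℂ) (hB : Bᵀ = B) : sp (Fin n) ℂ :=
  ⟨fromBlocks 0 B 0 0, by simpa using fromBlocks_mem_sp 0 B 0 hB (by simp)⟩

/-- The element of `sp_{2n}(ℂ)` with lower left block `C`. -/
def lower (C : Matrix (Fin n) (Fin n) ℂ) (hC : Cᵀ = C) : sp (Fin n) ℂ :=
  ⟨fromBlocks 0 0 C 0, by simpa using fromBlocks_mem_sp 0 0 C (by simp) hC⟩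

theorem lie_levi_one_upper (B : Matrix (Fin n) (Fin n) ℂ) (hB : Bᵀ = B) :
    ⁅(levi 1 : sp (Fin n) ℂ), upper B hB⁆ = (2 : ℂ) • upper B hB := by
  ext1
  simp [levi, upper, Ring.lie_def, fromBlocks_multiply, two_smul, fromBlocks_add,
    sub_eq_add_neg, fromBlocks_neg]

theorem lie_levi_one_lower (C : Matrix (Fin n) (Fin n) ℂ) (hC : Cᵀ = C) :
    ⁅(levi 1 : sp (Fin n) ℂ), lower C hC⁆ = (-2 : ℂ) • lower C hC := by
  ext1
  simp [levi, lower, Ring.lie_def, fromBlocks_multiply, two_smul, fromBlocks_add,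
    sub_eq_add_neg, fromBlocks_neg]

theorem lie_upper_lower (B C : Matrix (Fin n) (Fin n) ℂ) (hB : Bᵀ = B) (hC : Cᵀ = C) :
    ⁅upper B hB, lower C hC⁆ = levi (B * C) := by
  ext1
  simp [levi, lower, upper, Ring.lie_def, fromBlocks_multiply, fromBlocks_add,
    sub_eq_add_neg, fromBlocks_neg, hB, hC]

theorem exists_eq_add (x : sp (Fin n) ℂ) : ∃ (A B C : Matrix (Fin n) (Fin n) ℂ) (hB : Bᵀ = B)
    (hC : Cᵀ = C), x = levi A + upper B hB + lower C hC := by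
  obtain ⟨A, B, C, hB, hC, hx⟩ := exists_eq_fromBlocks x
  refine ⟨A, B, C, hB, hC, ?_⟩
  ext1
  simp [hx, levi, upper, lower, fromBlocks_add]

/-- `sp_{2n}(ℂ)` is perfect: a linear form vanishing on all brackets is zero. -/
theorem eq_zero_of_forall_lie (f : sp (Fin n) ℂ →ₗ[ℂ] ℂ)
    (hf : ∀ x y : sp (Fin n) ℂ, f ⁅x, y⁆ = 0) :
    f = 0 := by
  have hd : f ∘ₗ levi = 0 := by
    apply Matrix.ext_linearMap
    intro i j
    ext
    -- Products of two symmetric matrices are Levi parts of brackets, so it suffices to factor each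
    -- matrix unit this way.
    have key : ∀ (B C : Matrix (Fin n) (Fin n) ℂ), Bᵀ = B → Cᵀ = C → B * C = single i j 1 →
        f (levi (single i j 1)) = 0 := fun B C hB hC h => by
      rw [← h, ← lie_upper_lower B C hB hC, hf]
    simp only [LinearMap.comp_apply, singleLinearMap_apply, LinearMap.zero_apply]
    by_cases hij : i = j
    · subst hij
      exact key (single i i 1) (single i i 1) (by simp) (by simp) (by simp)
    · exact key (single i j 1 + single j i 1) (single j j 1) (by simp [add_comm]) (by simp)
        (by rw [add_mul, single_mul_single_same, single_mul_single_of_ne _ _ _ _ hij, mul_one,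
          add_zero])
  ext x
  obtain ⟨A, B, C, hB, hC, rfl⟩ := exists_eq_add x
  have h1 : f (levi A) = 0 := LinearMap.congr_fun hd A
  have h2 : f (upper B hB) = 0 := by
    have := hf (levi 1) (upper B hB)
    simpa [lie_levi_one_upper] using this
  have h3 : f (lower C hC) = 0 := by
    have := hf (levi 1) (lower C hC)
    simpa [lie_levi_one_lower] using this
  simp [h1, h2, h3]

theorem levi_one_mulVec_levi_one_mulVec (v : Fin n ⊕ Fin n → ℂ) :
    (levi 1 : sp (Fin n) ℂ).1 *ᵥ (levi 1 : sp (Fin n) ℂ).1 *ᵥ v = v := by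
  simp [levi, mulVec_mulVec, fromBlocks_multiply]

/-- The eigenvalues of `ad diag(1, -1)` on `sp_{2n}(ℂ)` are `0, 2, -2`. -/
theorem eq_zero_of_lie_levi_one_lie_levi_one (x : sp (Fin n) ℂ)
    (h : ⁅(levi 1 : sp (Fin n) ℂ), ⁅(levi 1 : sp (Fin n) ℂ), x⁆⁆ = x) : x = 0 := by
  obtain ⟨A, B, C, hB, hC, rfl⟩ := exists_eq_add x
  have h0 : ⁅(levi 1 : sp (Fin n) ℂ), levi A⁆ = 0 := by
    ext1
    simp [levi, Ring.lie_def, fromBlocks_multiply]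
  simp only [lie_add, h0, lie_levi_one_upper, lie_levi_one_lower, lie_smul, smul_smul, lie_zero]
    at h
  have h' := congrArg Subtype.val h
  simp [levi, upper, lower, fromBlocks_add, fromBlocks_smul] at h'
  obtain ⟨rfl, h2, h3⟩ := h'
  -- `(ad E)²` multiplies `B` and `C` by 4, so a fixed point has `3B = 3C = 0`.
  have e2 : B = 0 := by
    have : (3 : ℂ) • B = 0 := by linear_combination (norm := module) h2
    simpa using this
  have e3 : C = 0 := by
    have : (3 : ℂ) • C = 0 := by linear_combination (norm := module) h3.1
    simpa using this
  subst e2 e3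
  ext1
  simp [levi, upper, lower]

end LieAlgebra.Symplectic

/-! ### Nondegeneracy of the alternating form. -/

namespace Heisenberg

variable {n : ℕ}

theorem form_swap (v w : Fin n ⊕ Fin n → ℂ) : form v w = -form w v := by
  simp only [form, ← Finset.sum_neg_distrib]
  exact Finset.sum_congr rfl fun i _ => by ring

theorem form_single_inl (v : Fin n ⊕ Fin n → ℂ) (i : Fin n) :
    form v (Pi.single (Sum.inl i) 1) = -v (Sum.inr i) := by
  simp [form, Pi.single_apply]

theorem form_single_inr (v : Fin n ⊕ Fin n → ℂ) (i : Fin n) :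
    form v (Pi.single (Sum.inr i) 1) = v (Sum.inl i) := by
  simp [form, Pi.single_apply]

theorem eq_zero_of_forall_form (v : Fin n ⊕ Fin n → ℂ) (h : ∀ w, form v w = 0) : v = 0 := by
  ext (i | i)
  · simpa [form_single_inr] using h (Pi.single (Sum.inr i) 1)
  · simpa [form_single_inl] using h (Pi.single (Sum.inl i) 1)

end Heisenberg

/-! ### Components of elements and brackets. -/

namespace SymplecticOscillator

open Heisenberg

variable {n : ℕ}

theorem symplecticAction_apply (x : sp (Fin n) ℂ) (u : Heisenberg n) :
    symplecticAction n x u = ⟨x.1 *ᵥ u.vec, 0⟩ := rfl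

/-- The inclusion of `ℂ²ⁿ`. -/
def ofVec : (Fin n ⊕ Fin n → ℂ) →ₗ[ℂ] SymplecticOscillator n where
  toFun v := ⟨⟨v, 0⟩, 0⟩
  map_add' v w := by ext1 <;> simp; ext1 <;> simp
  map_smul' c v := by ext1 <;> simp; ext1 <;> simp

/-- The inclusion of `sp_{2n}(ℂ)`. -/
def ofSp : sp (Fin n) ℂ →ₗ[ℂ] SymplecticOscillator n where
  toFun x := ⟨0, x⟩
  map_add' v w := by ext1 <;> simp
  map_smul' c v := by ext1 <;> simp

/-- The central element `z`. -/
def z : SymplecticOscillator n := ⟨⟨0, 1⟩, 0⟩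

/-- The projection to `ℂ²ⁿ`. -/
def toVec : SymplecticOscillator n →ₗ[ℂ] (Fin n ⊕ Fin n → ℂ) where
  toFun a := a.left.vec
  map_add' v w := by simp
  map_smul' c v := by simp

/-- The coefficient of `z`. -/
def toCentral : SymplecticOscillator n →ₗ[ℂ] ℂ where
  toFun a := a.left.central
  map_add' v w := by simp
  map_smul' c v := by simp

/-- The projection to `sp_{2n}(ℂ)`. -/
def toSp : SymplecticOscillator n →ₗ[ℂ] sp (Fin n) ℂ where
  toFun a := a.right
  map_add' v w := by simp
  map_smul' c v := by simp

theorem ofVec_apply (v : Fin n ⊕ Fin n → ℂ) :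
    (ofVec v : SymplecticOscillator n) = ⟨⟨v, 0⟩, 0⟩ := rfl

theorem ofSp_apply (x : sp (Fin n) ℂ) : (ofSp x : SymplecticOscillator n) = ⟨0, x⟩ := rfl

theorem toVec_apply (a : SymplecticOscillator n) : toVec a = a.left.vec := rfl

theorem toCentral_apply (a : SymplecticOscillator n) : toCentral a = a.left.central := rfl

theorem toSp_apply (a : SymplecticOscillator n) : toSp a = a.right := rfl

theorem eq_add (a : SymplecticOscillator n) :
    a = ofVec (toVec a) + toCentral a • z + ofSp (toSp a) := by
  ext1
  · ext1 <;> simp [ofVec_apply, toVec_apply, toCentral_apply, z, ofSp_apply, toSp_apply]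
  · simp [ofVec_apply, toVec_apply, toCentral_apply, z, ofSp_apply, toSp_apply]

theorem eq_zero {a : SymplecticOscillator n} (h1 : toVec a = 0) (h2 : toCentral a = 0)
    (h3 : toSp a = 0) : a = 0 := by
  rw [eq_add a, h1, h2, h3]; simp only [map_zero, zero_smul, add_zero]

theorem linearMap_ext {M : Type*} [AddCommGroup M] [Module ℂ M]
    {f : SymplecticOscillator n →ₗ[ℂ] M} (h1 : ∀ v, f (ofVec v) = 0) (h2 : f z = 0)
    (h3 : ∀ x, f (ofSp x) = 0) : f = 0 := by
  ext a
  rw [eq_add a]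
  simp only [map_add, map_smul, h1, h2, h3, smul_zero, add_zero, LinearMap.zero_apply]

theorem lie_z (a : SymplecticOscillator n) : ⁅a, (z : SymplecticOscillator n)⁆ = 0 := by
  ext1
  · ext1 <;> simp [z, form, symplecticAction_apply]
  · simp [z]

theorem ofSp_lie (x y : sp (Fin n) ℂ) : ⁅ofSp x, ofSp y⁆ = ofSp ⁅x, y⁆ := by
  ext1 <;> simp [ofSp_apply]

theorem ofSp_lie_ofVec (x : sp (Fin n) ℂ) (v : Fin n ⊕ Fin n → ℂ) :
    ⁅ofSp x, ofVec v⁆ = ofVec (x.1 *ᵥ v) := by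
  ext1
  · ext1 <;> simp [ofSp_apply, ofVec_apply, symplecticAction_apply]
  · simp [ofSp_apply, ofVec_apply]

theorem ofVec_lie_ofVec (v w : Fin n ⊕ Fin n → ℂ) : ⁅ofVec v, ofVec w⁆ = form v w • z := by
  ext1
  · ext1 <;> simp [ofVec_apply, z]
  · simp [z, ofVec_apply]

theorem toVec_ofSp_lie (x : sp (Fin n) ℂ) (a : SymplecticOscillator n) :
    toVec ⁅ofSp x, a⁆ = x.1 *ᵥ toVec a := by
  simp [toVec_apply, ofSp_apply, symplecticAction_apply]

theorem toCentral_ofSp_lie (x : sp (Fin n) ℂ) (a : SymplecticOscillator n) :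
    toCentral ⁅ofSp x, a⁆ = 0 := by
  simp [toCentral_apply, ofSp_apply, symplecticAction_apply]

theorem toSp_ofSp_lie (x : sp (Fin n) ℂ) (a : SymplecticOscillator n) :
    toSp ⁅ofSp x, a⁆ = ⁅x, toSp a⁆ := by
  simp [toSp_apply, ofSp_apply]

theorem toVec_ofVec_lie (v : Fin n ⊕ Fin n → ℂ) (a : SymplecticOscillator n) :
    toVec ⁅ofVec v, a⁆ = -((toSp a).1 *ᵥ v) := by
  simp [toVec_apply, toSp_apply, ofVec_apply, symplecticAction_apply]

theorem toCentral_ofVec_lie (v : Fin n ⊕ Fin n → ℂ) (a : SymplecticOscillator n) :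
    toCentral ⁅ofVec v, a⁆ = form v (toVec a) := by
  simp [toCentral_apply, toVec_apply, ofVec_apply, symplecticAction_apply]

theorem toSp_ofVec_lie (v : Fin n ⊕ Fin n → ℂ) (a : SymplecticOscillator n) :
    toSp ⁅ofVec v, a⁆ = 0 := by
  simp [toSp_apply, ofVec_apply]

end SymplecticOscillator

open SymplecticOscillator Heisenberg

/-! ### Vanishing of the components of `δ`. -/

namespace IsSymmetricBiderivation

variable {n : ℕ}
  {δ : SymplecticOscillator n →ₗ[ℂ] SymplecticOscillator n →ₗ[ℂ] SymplecticOscillator n}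

/-- The values of `δ z` are central, hence multiples of `z`; therefore `δ z` kills all brackets, and
these span the algebra. -/
theorem apply_z (hn : 1 ≤ n) (hδ : IsSymmetricBiderivation δ) (a : SymplecticOscillator n) :
    δ a z = 0 := by
  have hc : ∀ x w, ⁅x, δ z w⁆ = 0 := fun x w => by
    have h := hδ.left x z w
    have h' : ∀ b : SymplecticOscillator n, ⁅z, b⁆ = 0 := fun b => by
      rw [← lie_skew, lie_z, neg_zero]
    rw [lie_z, h', map_zero, LinearMap.zero_apply, sub_zero] at h
    exact h.symm
  have hb : ∀ x y, δ z ⁅x, y⁆ = 0 := fun x y => by rw [hδ.right, hc, hc, sub_zero]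
  have hS : ∀ w, toSp (δ z w) = 0 := fun w => by
    ext1
    apply Matrix.ext_of_mulVec_single
    intro i
    have := congrArg toVec (hc (ofVec (Pi.single i 1)) w)
    rw [toVec_ofVec_lie, map_zero, neg_eq_zero] at this
    rw [this, ZeroMemClass.coe_zero, zero_mulVec]
  have hV : ∀ w, toVec (δ z w) = 0 := fun w => by
    have := congrArg toVec (hc (ofSp (levi 1)) w)
    rw [toVec_ofSp_lie, map_zero] at this
    rw [← levi_one_mulVec_levi_one_mulVec (toVec (δ z w)), this, mulVec_zero]
  rw [hδ.symm]
  suffices h : δ z = 0 by rw [h, LinearMap.zero_apply]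
  apply linearMap_ext
  · intro v
    rw [← levi_one_mulVec_levi_one_mulVec v, ← ofSp_lie_ofVec, hb]
  · have := hb (ofVec (Pi.single (Sum.inl ⟨0, hn⟩) 1)) (ofVec (Pi.single (Sum.inr ⟨0, hn⟩) 1))
    rw [ofVec_lie_ofVec, form_single_inr, Pi.single_eq_same, one_smul] at this
    exact this
  · intro x
    refine eq_zero (hV _) ?_ (hS _)
    have h := eq_zero_of_forall_lie (toCentral ∘ₗ δ z ∘ₗ ofSp) fun x y => by
      simp only [LinearMap.comp_apply, ← ofSp_lie, hb, map_zero]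
    exact LinearMap.congr_fun h x

theorem toSp_apply_ofVec (hδ : IsSymmetricBiderivation δ) (a : SymplecticOscillator n)
    (v : Fin n ⊕ Fin n → ℂ) : toSp (δ a (ofVec v)) = 0 := by
  have h : ∀ (x : sp (Fin n) ℂ) v, toSp (δ a (ofVec (x.1 *ᵥ v))) =
      ⁅x, toSp (δ a (ofVec v))⁆ := fun x v => by
    rw [← ofSp_lie_ofVec, hδ.right, map_sub, toSp_ofSp_lie, toSp_ofVec_lie, sub_zero]
  apply eq_zero_of_lie_levi_one_lie_levi_one
  rw [← h, ← h, levi_one_mulVec_levi_one_mulVec]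

theorem toVec_apply_mulVec (hδ : IsSymmetricBiderivation δ) (a : SymplecticOscillator n)
    (x : sp (Fin n) ℂ) (v : Fin n ⊕ Fin n → ℂ) : toVec (δ a (ofVec (x.1 *ᵥ v))) =
      x.1 *ᵥ toVec (δ a (ofVec v)) + (toSp (δ a (ofSp x))).1 *ᵥ v := by
  rw [← ofSp_lie_ofVec, hδ.right, map_sub, toVec_ofSp_lie, toVec_ofVec_lie, sub_neg_eq_add]

theorem toCentral_apply_mulVec (hδ : IsSymmetricBiderivation δ) (a : SymplecticOscillator n)
    (x : sp (Fin n) ℂ) (v : Fin n ⊕ Fin n → ℂ) : toCentral (δ a (ofVec (x.1 *ᵥ v))) =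
      form (toVec (δ a (ofSp x))) v := by
  rw [← ofSp_lie_ofVec, hδ.right, map_sub, toCentral_ofSp_lie, toCentral_ofVec_lie, zero_sub,
    form_swap, neg_neg]

/-- This is the central part of `δ a ⁅v, w⁆`, which vanishes because `⁅v, w⁆` is a multiple of `z`.
-/
theorem form_toVec_apply (hn : 1 ≤ n) (hδ : IsSymmetricBiderivation δ) (a : SymplecticOscillator n)
    (v w : Fin n ⊕ Fin n → ℂ) :
    form v (toVec (δ a (ofVec w))) = form w (toVec (δ a (ofVec v))) := by
  have h := hδ.right a (ofVec v) (ofVec w)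
  rw [ofVec_lie_ofVec, map_smul, hδ.apply_z hn, smul_zero] at h
  have h' := congrArg toCentral h
  rw [map_zero, map_sub, toCentral_ofVec_lie, toCentral_ofVec_lie] at h'
  exact (sub_eq_zero.1 h'.symm)

theorem toCentral_apply_ofSp (hδ : IsSymmetricBiderivation δ) (a : SymplecticOscillator n)
    (x : sp (Fin n) ℂ) : toCentral (δ a (ofSp x)) = 0 := by
  have h := eq_zero_of_forall_lie (toCentral ∘ₗ δ a ∘ₗ ofSp) fun x y => by
    simp only [LinearMap.comp_apply, ← ofSp_lie, hδ.right, map_sub, toCentral_ofSp_lie, sub_zero]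
  exact LinearMap.congr_fun h x

theorem lie_upper_lower_one :
    ⁅upper (1 : Matrix (Fin n) (Fin n) ℂ) transpose_one,
      lower (1 : Matrix (Fin n) (Fin n) ℂ) transpose_one⁆ = levi 1 := by
  rw [lie_upper_lower, one_mul]

theorem lie_mulVec (x y : sp (Fin n) ℂ) (v : Fin n ⊕ Fin n → ℂ) :
    (⁅x, y⁆ : sp (Fin n) ℂ).1 *ᵥ v = x.1 *ᵥ y.1 *ᵥ v - y.1 *ᵥ x.1 *ᵥ v := by
  simp [Ring.lie_def, sub_mulVec, mulVec_mulVec]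

/-- Equivariance holds in each argument separately, so applying `x` in one and `y` in the other
shows that `x` and `y` commute on the value; `E` is a commutator and is invertible on `V`. -/
theorem toVec_apply_ofVec_ofVec (hδ : IsSymmetricBiderivation δ) (v w : Fin n ⊕ Fin n → ℂ) :
    toVec (δ (ofVec v) (ofVec w)) = 0 := by
  have hr : ∀ (x : sp (Fin n) ℂ) v w, toVec (δ (ofVec v) (ofVec (x.1 *ᵥ w))) =
      x.1 *ᵥ toVec (δ (ofVec v) (ofVec w)) := fun x v w => by
    rw [hδ.toVec_apply_mulVec, hδ.symm _ (ofSp x), hδ.toSp_apply_ofVec]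
    simp
  have hl : ∀ (x : sp (Fin n) ℂ) v w, toVec (δ (ofVec (x.1 *ᵥ v)) (ofVec w)) =
      x.1 *ᵥ toVec (δ (ofVec v) (ofVec w)) := fun x v w => by
    rw [hδ.symm, hr, hδ.symm]
  have hc : ∀ x y : sp (Fin n) ℂ,
      (⁅x, y⁆ : sp (Fin n) ℂ).1 *ᵥ toVec (δ (ofVec v) (ofVec w)) = 0 := fun x y => by
    rw [lie_mulVec, sub_eq_zero]
    calc _ = toVec (δ (ofVec (x.1 *ᵥ v)) (ofVec (y.1 *ᵥ w))) := by rw [hl, hr]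
      _ = _ := by rw [hr, hl]
  have := hc (upper 1 transpose_one) (lower 1 transpose_one)
  rw [lie_upper_lower_one] at this
  rw [← levi_one_mulVec_levi_one_mulVec (toVec _), this, mulVec_zero]

theorem toVec_apply_ofSp_ofSp (hδ : IsSymmetricBiderivation δ) (x y : sp (Fin n) ℂ) :
    toVec (δ (ofSp x) (ofSp y)) = 0 := by
  apply eq_zero_of_forall_form
  intro v
  rw [← hδ.toCentral_apply_mulVec, hδ.symm, hδ.toCentral_apply_ofSp]

theorem toCentral_apply_ofVec_ofVec (hn : 1 ≤ n) (hδ : IsSymmetricBiderivation δ)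
    (v w : Fin n ⊕ Fin n → ℂ) : toCentral (δ (ofVec v) (ofVec w)) = 0 := by
  -- Self-adjointness: `β(w, xv) = form (toVec (δ x w)) v`, and the right side is symmetric in `v`
  -- and `w` by `form_toVec_apply`.
  have hs : ∀ (x : sp (Fin n) ℂ) v w, toCentral (δ (ofVec w) (ofVec (x.1 *ᵥ v))) =
      toCentral (δ (ofVec (x.1 *ᵥ w)) (ofVec v)) := fun x v w => by
    rw [hδ.symm (ofVec (x.1 *ᵥ w)), hδ.toCentral_apply_mulVec, hδ.toCentral_apply_mulVec,
      hδ.symm _ (ofSp x), hδ.symm _ (ofSp x), form_swap, hδ.form_toVec_apply hn, ← form_swap]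
  have hc : ∀ (x y : sp (Fin n) ℂ) w,
      toCentral (δ (ofVec v) (ofVec ((⁅x, y⁆ : sp (Fin n) ℂ).1 *ᵥ w))) = 0 := fun x y w => by
    have h1 : toCentral (δ (ofVec v) (ofVec ((⁅x, y⁆ : sp (Fin n) ℂ).1 *ᵥ w))) =
        -toCentral (δ (ofVec ((⁅x, y⁆ : sp (Fin n) ℂ).1 *ᵥ v)) (ofVec w)) := by
      simp only [lie_mulVec, map_sub, LinearMap.sub_apply, hs]
      ring
    rw [← hs] at h1
    exact self_eq_neg.1 h1
  -- Evaluating at `E w` recovers `w`, since `E² = 1`.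
  have h := hc (upper 1 transpose_one) (lower 1 transpose_one) ((levi 1 : sp (Fin n) ℂ).1 *ᵥ w)
  rwa [lie_upper_lower_one, levi_one_mulVec_levi_one_mulVec] at h

theorem toVec_apply_ofVec_ofSp (hn : 1 ≤ n) (hδ : IsSymmetricBiderivation δ)
    (v : Fin n ⊕ Fin n → ℂ) (x : sp (Fin n) ℂ) : toVec (δ (ofVec v) (ofSp x)) = 0 := by
  apply eq_zero_of_forall_form
  intro w
  rw [← hδ.toCentral_apply_mulVec, hδ.toCentral_apply_ofVec_ofVec hn]

/-- In `toVec_apply_mulVec` both mixed terms vanish, so this element of `sp` annihilates `V`. -/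
theorem toSp_apply_ofSp_ofSp (hn : 1 ≤ n) (hδ : IsSymmetricBiderivation δ)
    (x y : sp (Fin n) ℂ) : toSp (δ (ofSp x) (ofSp y)) = 0 := by
  ext1
  apply Matrix.ext_of_mulVec_single
  intro i
  have h := hδ.toVec_apply_mulVec (ofSp x) y (Pi.single i 1)
  rw [hδ.symm, hδ.toVec_apply_ofVec_ofSp hn, hδ.symm, hδ.toVec_apply_ofVec_ofSp hn, mulVec_zero,
    zero_add] at h
  rw [← h, ZeroMemClass.coe_zero, zero_mulVec]

theorem apply_ofVec_ofSp (hn : 1 ≤ n) (hδ : IsSymmetricBiderivation δ)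
    (v : Fin n ⊕ Fin n → ℂ) (x : sp (Fin n) ℂ) : δ (ofVec v) (ofSp x) = 0 :=
  eq_zero (hδ.toVec_apply_ofVec_ofSp hn v x) (hδ.toCentral_apply_ofSp _ x)
    (by rw [hδ.symm, hδ.toSp_apply_ofVec])

end IsSymmetricBiderivation

theorem mainTheorem10 (n : ℕ) (hn : 1 ≤ n)
    (δ : SymplecticOscillator n →ₗ[ℂ] SymplecticOscillator n →ₗ[ℂ] SymplecticOscillator n)
    (hδ : IsSymmetricBiderivation δ) : δ = 0 := by
  apply linearMap_ext
  · exact fun v => linearMap_ext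
      (fun w => eq_zero (hδ.toVec_apply_ofVec_ofVec v w) (hδ.toCentral_apply_ofVec_ofVec hn v w)
        (hδ.toSp_apply_ofVec _ w))
      (hδ.apply_z hn _) (hδ.apply_ofVec_ofSp hn v)
  · ext1 a
    rw [hδ.symm, hδ.apply_z hn, LinearMap.zero_apply]
  · exact fun x => linearMap_ext (fun v => by rw [hδ.symm, hδ.apply_ofVec_ofSp hn])
      (hδ.apply_z hn _)
      (fun y => eq_zero (hδ.toVec_apply_ofSp_ofSp x y) (hδ.toCentral_apply_ofSp _ y)
        (hδ.toSp_apply_ofSp_ofSp hn x y))
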